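/- Let $d\in\{1,2,3\}$, let $\Omega\subset\mathbb R^d$ be a bounded open set (in particular, $\Omega$ may be a bounded interval or a bounded polygonal/polyhedral domain), let $\nu>0$, $y_d\in L^2(\Omega)$ and $u_d\in L^\infty(\Omega)$. Consider the optimal control problem $$ \text{(P)}\qquad \begin{aligned} &\min_{(y,u)\in H^1_0(\Omega)\times L^2(\Omega)} J(y,u):=\tfrac12\|y-y_d\|_{L^2(\Omega)}^2+\tfrac{\nu}{2}\|u-u_d\|_{L^2(\Omega)}^2\\ &\text{s.t. } \int_\Omega \nabla y\cdot\nabla(v-y)\,dx+\|v\|_{L^1(\Omega)}-\|y\|_{L^1(\Omega)}\ \ge\ \int_\Omega u\,(v-y)\,dx\qquad\forall v\in H^1_0(\Omega). \end{aligned} $$ A control $\bar u\in L^2(\Omega)$ with associated state $\bar y\in H^1_0(\Omega)$ (i.e. $(\bar y,\bar u)$ satisfies the variational inequality) is called locally optimal if there is $\varepsilon>0$ such that $J(\bar y,\bar u)\le J(y,u)$ for every $u\in L^2(\Omega)$ with $\|u-\bar u\|_{L^2(\Omega)}\le\varepsilon$ and every $y\in H^1_0(\Omega)$ such that $(y,u)$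 satisfies the variational inequality. Then every locally optimal control $\bar u$ of (P) satisfies $\bar u\in L^\infty(\Omega)$ if $d=1$; $\bar u\in L^\kappa(\Omega)$ for every $\kappa\in[1,\infty)$ if $d=2$; and $\bar u\in L^6(\Omega)$ if $d=3$. -/

import Mathlib

open MeasureTheory
open scoped ENNReal

noncomputable section

namespace VIControl

open scoped ContDiff Gradient

/-- `L²(Ω)`, with respect to Lebesgue measure restricted to `Ω ⊆ ℝᵈ`. -/
abbrev L2 {d : ℕ} (Ω : Set (EuclideanSpace ℝ (Fin d))) : Type :=
  Lp ℝ 2 (volume.restrict Ω)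

/-- `L²(Ω; ℝᵈ)`, the space of square integrable vector fields on `Ω ⊆ ℝᵈ`. -/
abbrev L2Vec {d : ℕ} (Ω : Set (EuclideanSpace ℝ (Fin d))) : Type :=
  Lp (EuclideanSpace ℝ (Fin d)) 2 (volume.restrict Ω)

/-- The Hilbert space `L²(Ω) × L²(Ω; ℝᵈ)`. A function `y ∈ H¹(Ω)` is identified with the pair
`(y, ∇y)`, and the norm of that pair is the `H¹(Ω)` norm of `y`. -/
abbrev GraphSpace {d : ℕ} (Ω : Set (EuclideanSpace ℝ (Fin d))) : Type :=
  WithLp 2 (L2 Ω × L2Vec Ω)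

/-- The space `C_c^∞(Ω)` of test functions `φ`, embedded as the pairs `(φ, ∇φ)`. -/
def testFunctions {d : ℕ} (Ω : Set (EuclideanSpace ℝ (Fin d))) :
    Submodule ℝ (GraphSpace Ω) where
  carrier := {w | ∃ φ : EuclideanSpace ℝ (Fin d) → ℝ,
    ContDiff ℝ ∞ φ ∧ HasCompactSupport φ ∧ tsupport φ ⊆ Ω ∧
    w.fst =ᵐ[volume.restrict Ω] φ ∧ w.snd =ᵐ[volume.restrict Ω] ∇ φ}
  add_mem' := by
    rintro a b ⟨φ, h1, h2, h3, h4, h5⟩ ⟨ψ, k1, k2, k3, k4, k5⟩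
    refine ⟨φ + ψ, h1.add k1, h2.add k2,
      (tsupport_add φ ψ).trans (Set.union_subset h3 k3), ?_, ?_⟩
    · exact (Lp.coeFn_add a.fst b.fst).trans (h4.add k4)
    · have hg : ∇ (φ + ψ) = ∇ φ + ∇ ψ := by
        funext x
        simp only [gradient, Pi.add_apply]
        rw [fderiv_add (h1.differentiable (by simp) x) (k1.differentiable (by simp) x), map_add]
      rw [hg]
      exact (Lp.coeFn_add a.snd b.snd).trans (h5.add k5)
  zero_mem' := by
    refine ⟨0, contDiff_const, HasCompactSupport.zero, by simp, ?_, ?_⟩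
    · exact Lp.coeFn_zero _ _ _
    · have hg : ∇ (0 : EuclideanSpace ℝ (Fin d) → ℝ) = 0 := by
        funext x
        simp [gradient]
      rw [hg]
      exact Lp.coeFn_zero _ _ _
  smul_mem' := by
    rintro c a ⟨φ, h1, h2, h3, h4, h5⟩
    refine ⟨c • φ, h1.const_smul c, h2.mono (Function.support_const_smul_subset c φ),
      (closure_mono (Function.support_const_smul_subset c φ)).trans h3, ?_, ?_⟩
    · exact (Lp.coeFn_smul c a.fst).trans (h4.const_smul c)
    · have hg : ∇ (c • φ) = c • ∇ φ := by
        funext x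
        simp only [gradient, Pi.smul_apply]
        rw [fderiv_const_smul (h1.differentiable (by simp) x), map_smul]
      rw [hg]
      exact (Lp.coeFn_smul c a.snd).trans (h5.const_smul c)

/-- The Sobolev space `H¹₀(Ω)`: the closure of `C_c^∞(Ω)` in the `H¹(Ω)` norm. An element `y` is
the pair of the function `y.fst ∈ L²(Ω)` and its weak gradient `y.snd ∈ L²(Ω; ℝᵈ)`. -/
def H10 {d : ℕ} (Ω : Set (EuclideanSpace ℝ (Fin d))) : Submodule ℝ (GraphSpace Ω) :=
  (testFunctions Ω).topologicalClosure

/-- `y ∈ H¹₀(Ω)` is the state that belongs to the control `u ∈ L²(Ω)`, i.e. it solves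
`(∇y, ∇(v - y)) + ‖v‖_{L¹} - ‖y‖_{L¹} ≥ (u, v - y)` for all `v ∈ H¹₀(Ω)`. -/
def IsState {d : ℕ} (Ω : Set (EuclideanSpace ℝ (Fin d))) (u : L2 Ω) (y : GraphSpace Ω) : Prop :=
  y ∈ H10 Ω ∧ ∀ v ∈ H10 Ω,
    ∫ x in Ω, u x * (v.fst x - y.fst x) ≤
      (∫ x in Ω, inner ℝ (y.snd x) (v.snd x - y.snd x))
        + (∫ x in Ω, |v.fst x|) - ∫ x in Ω, |y.fst x|

/-- The objective `J(y, u) = ½ ‖y - y_d‖² + ν/2 ‖u - u_d‖²`, with `L²(Ω)` norms. -/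
def objective {d : ℕ} {Ω : Set (EuclideanSpace ℝ (Fin d))} (ν : ℝ) (yd ud : L2 Ω)
    (y : GraphSpace Ω) (u : L2 Ω) : ℝ :=
  1 / 2 * ‖y.fst - yd‖ ^ 2 + ν / 2 * ‖u - ud‖ ^ 2

/-- `ubar ∈ L²(Ω)` is a locally optimal control: together with its state it minimizes the objective
among all controls in an `L²(Ω)` ball around `ubar` and their states. -/
def IsLocallyOptimal {d : ℕ} (Ω : Set (EuclideanSpace ℝ (Fin d))) (ν : ℝ) (yd ud : L2 Ω)
    (ubar : L2 Ω) : Prop :=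
  ∃ ybar : GraphSpace Ω, IsState Ω ubar ybar ∧
    ∃ ε > 0, ∀ (u : L2 Ω) (y : GraphSpace Ω), ‖u - ubar‖ ≤ ε → IsState Ω u y →
      objective ν yd ud ybar ubar ≤ objective ν yd ud y u

end VIControl

end

/-! No differentiability of the control-to-state map and no multiplier system is needed, only its
Lipschitz continuity from the dual norm `‖E.adjoint ·‖` (an `H⁻¹` norm) into `H¹₀`
(`SolvesVI.norm_sub_le`). Moving a local minimizer by `r • k` changes the tracking term by at most a
constant times `r * ‖E.adjoint k‖` to first order, while the control cost contributes `r * ν * inner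
(ubar - ud) k`. Letting `r` tend to zero and using both signs of `k` gives `|inner (ubar - ud) k| ≤
C / ν * ‖E.adjoint k‖`. Thus `ubar - ud` acts continuously in the dual norm, and by Hahn-Banach and
Riesz it lies in the range of `E`, that is, in `H¹₀` (`exists_eq_sub_of_locallyOptimal`). The
Sobolev inequality for `H¹₀` and boundedness of `ud` then give the integrability of `ubar`. -/

/-! ### Variational inequalities and local optimality in Hilbert spaces -/

section Abstract

open Filter Topology

/-- A continuous function that is bounded below and uniformly midpoint convex attains its minimum
on a complete space. -/
theorem exists_forall_le_of_midpoint {H : Type*} [NormedAddCommGroup H] [NormedSpace ℝ H]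
    [CompleteSpace H] {F : H → ℝ} (hF : Continuous F) (hbdd : BddBelow (Set.range F)) {c : ℝ}
    (hc : 0 < c)
    (hmid : ∀ x y, F ((1 / 2 : ℝ) • (x + y)) + c * ‖x - y‖ ^ 2 ≤ (F x + F y) / 2) :
    ∃ x, ∀ y, F x ≤ F y := by
  set m := sInf (Set.range F) with hm
  have hle : ∀ y, m ≤ F y := fun y => csInf_le hbdd ⟨y, rfl⟩
  have hex : ∀ n : ℕ, ∃ x, F x < m + 1 / ((n : ℝ) + 1) := by
    intro n
    obtain ⟨_, ⟨x, rfl⟩, hx⟩ := exists_lt_of_csInf_lt (Set.range_nonempty F)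
      (show sInf (Set.range F) < m + 1 / ((n : ℝ) + 1) from
        lt_add_of_pos_right _ (by positivity))
    exact ⟨x, hx⟩
  choose x hx using hex
  have hdec : ∀ {N n : ℕ}, N ≤ n → F (x n) ≤ m + 1 / ((N : ℝ) + 1) := fun h =>
    (hx _).le.trans (by gcongr)
  have hlim : Tendsto (fun N : ℕ => √((1 / ((N : ℝ) + 1)) / c)) atTop (𝓝 0) := by
    have h := (tendsto_one_div_add_atTop_nhds_zero_nat (𝕜 := ℝ)).div_const c
    simpa using h.sqrt
  -- The midpoint of two near-minimizers still has value at least `m`, so `hmid` forces them to be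
  -- close.
  have hcau : CauchySeq x := by
    refine cauchySeq_of_le_tendsto_0 _ (fun n k N hn hk => ?_) hlim
    rw [dist_eq_norm]
    refine Real.le_sqrt_of_sq_le ?_
    rw [le_div_iff₀ hc]
    have h1 := hmid (x n) (x k)
    have h2 := hle ((1 / 2 : ℝ) • (x n + x k))
    have h3 := hdec hn
    have h4 := hdec hk
    linarith
  obtain ⟨a, ha⟩ := cauchySeq_tendsto_of_complete hcau
  have hFa : Tendsto (fun n => F (x n)) atTop (𝓝 (F a)) := (hF.tendsto a).comp ha
  have hup : Tendsto (fun n : ℕ => m + 1 / ((n : ℝ) + 1)) atTop (𝓝 m) := by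
    simpa using (tendsto_one_div_add_atTop_nhds_zero_nat (𝕜 := ℝ)).const_add m
  have : F a ≤ m := le_of_tendsto_of_tendsto' hFa hup fun n => (hx n).le
  exact ⟨a, fun y => this.trans (hle y)⟩

/-- Extracts first-order conditions: after division by the step length, `t * B` is the second-order
remainder and vanishes as `t → 0`. -/
theorem nonneg_of_forall_add_mul_nonneg {A B : ℝ}
    (h : ∀ t : ℝ, 0 < t → t ≤ 1 → 0 ≤ A + t * B) : 0 ≤ A := by
  have hlim : Tendsto (fun t : ℝ => A + t * B) (𝓝[>] 0) (𝓝 A) := by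
    have : Continuous fun t : ℝ => A + t * B := by fun_prop
    simpa using (this.tendsto 0).mono_left nhdsWithin_le_nhds
  refine ge_of_tendsto hlim ?_
  filter_upwards [Ioc_mem_nhdsGT (zero_lt_one' ℝ)] with t ht using h t ht.1 ht.2

variable {H K M : Type*} [NormedAddCommGroup H] [InnerProductSpace ℝ H]
  [NormedAddCommGroup K] [InnerProductSpace ℝ K]
  [NormedAddCommGroup M] [InnerProductSpace ℝ M]

/-- `y` solves the elliptic variational inequality of the second kind with right-hand side `u`. -/
def SolvesVI (E : H →L[ℝ] K) (G : H →L[ℝ] M) (j : K → ℝ) (u : K) (y : H) : Prop :=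
  ∀ v, inner ℝ u (E v - E y) ≤ inner ℝ (G y) (G v - G y) + j (E v) - j (E y)

/-- The inequality is the optimality condition for minimizing the strongly convex energy `1/2 * ‖G
v‖ ^ 2 + j (E v) - inner u (E v)`. -/
theorem exists_solvesVI [CompleteSpace H] (E : H →L[ℝ] K) (G : H →L[ℝ] M) {j : K → ℝ} (hj : Continuous j)
    (hj0 : ∀ x, 0 ≤ j x) (hconv : ConvexOn ℝ Set.univ j) {α : ℝ} (hα : 0 < α)
    (hG : ∀ v, α * ‖v‖ ^ 2 ≤ ‖G v‖ ^ 2) (u : K) : ∃ y, SolvesVI E G j u y := by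
  set F : H → ℝ := fun v => 1 / 2 * ‖G v‖ ^ 2 + j (E v) - inner ℝ u (E v) with hFdef
  have hF : Continuous F := by fun_prop
  have hbdd : BddBelow (Set.range F) := by
    refine ⟨-((‖u‖ * ‖E‖) ^ 2 / (2 * α)), ?_⟩
    rintro _ ⟨v, rfl⟩
    have h1 := hG v
    have h2 := hj0 (E v)
    have h3 : inner ℝ u (E v) ≤ ‖u‖ * ‖E‖ * ‖v‖ := by
      refine (real_inner_le_norm _ _).trans ?_
      rw [mul_assoc]
      gcongr
      exact E.le_opNorm v
    have h4 : ‖u‖ * ‖E‖ * ‖v‖ ≤ α / 2 * ‖v‖ ^ 2 + (‖u‖ * ‖E‖) ^ 2 / (2 * α) := by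
      have h : 0 ≤ (α * ‖v‖ - ‖u‖ * ‖E‖) ^ 2 / (2 * α) := by positivity
      have e : (α * ‖v‖ - ‖u‖ * ‖E‖) ^ 2 / (2 * α)
          = α / 2 * ‖v‖ ^ 2 + (‖u‖ * ‖E‖) ^ 2 / (2 * α) - ‖u‖ * ‖E‖ * ‖v‖ := by
        field_simp
        ring
      linarith
    simp only [hFdef]
    linarith
  -- By the parallelogram law the quadratic part gains exactly `‖G (x - y)‖ ^ 2 / 8`; coercivity
  -- turns this into `α / 8`.
  have hmid : ∀ x y, F ((1 / 2 : ℝ) • (x + y)) + α / 8 * ‖x - y‖ ^ 2 ≤ (F x + F y) / 2 := by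
    intro x y
    have h1 := hG (x - y)
    have h2 := hconv.2 (Set.mem_univ (E x)) (Set.mem_univ (E y))
      (show (0 : ℝ) ≤ 1 / 2 by norm_num) (show (0 : ℝ) ≤ 1 / 2 by norm_num) (by norm_num)
    have h3 := parallelogram_law_with_norm ℝ (G x) (G y)
    rw [← smul_add] at h2
    simp only [smul_eq_mul] at h2
    simp only [hFdef, map_smul, map_add, inner_smul_right, inner_add_right, norm_smul, mul_pow]
    rw [map_sub] at h1
    norm_num
    norm_num at h2
    linarith
  obtain ⟨y, hy⟩ := exists_forall_le_of_midpoint hF hbdd (by positivity) hmid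
  refine ⟨y, fun v => ?_⟩
  have key : 0 ≤ (inner ℝ (G y) (G v - G y) + j (E v) - j (E y) - inner ℝ u (E v - E y)) := by
    refine nonneg_of_forall_add_mul_nonneg (B := 1 / 2 * ‖G v - G y‖ ^ 2) fun t ht ht1 => ?_
    -- Compare the minimizer with a point on the segment to `v`; convexity bounds the increment of
    -- `j` linearly in `t`, so dividing by `t` is harmless.
    have h1 := hy (y + t • (v - y))
    have h2 := hconv.2 (Set.mem_univ (E y)) (Set.mem_univ (E v)) (sub_nonneg.2 ht1) ht.le
      (by ring)
    have e : (1 - t) • E y + t • E v = E y + t • (E v - E y) := by module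
    rw [e] at h2
    simp only [smul_eq_mul] at h2
    simp only [hFdef, map_add, map_smul, map_sub, inner_add_right, inner_smul_right] at h1
    rw [norm_add_sq_real, norm_smul, inner_smul_right, mul_pow, Real.norm_eq_abs, sq_abs] at h1
    refine le_of_mul_le_mul_left ?_ ht
    rw [mul_zero]
    linarith
  linarith

/-- Test each inequality with the other solution and add: the nonsmooth terms cancel. -/
theorem SolvesVI.norm_sub_sq_le {E : H →L[ℝ] K} {G : H →L[ℝ] M} {j : K → ℝ} {u₁ u₂ : K}
    {y₁ y₂ : H} (h₁ : SolvesVI E G j u₁ y₁) (h₂ : SolvesVI E G j u₂ y₂) :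
    ‖G (y₁ - y₂)‖ ^ 2 ≤ inner ℝ (u₁ - u₂) (E (y₁ - y₂)) := by
  have e1 := h₁ y₂
  have e2 := h₂ y₁
  rw [map_sub, map_sub, ← real_inner_self_eq_norm_sq]
  simp only [inner_sub_left, inner_sub_right] at *
  linarith [real_inner_comm (G y₁) (G y₂)]

/-- The state depends on the control in a Lipschitz way with respect to the dual norm. -/
theorem SolvesVI.norm_sub_le [CompleteSpace H] [CompleteSpace K] {E : H →L[ℝ] K} {G : H →L[ℝ] M} {j : K → ℝ} {α : ℝ} (hα : 0 < α)
    (hG : ∀ v, α * ‖v‖ ^ 2 ≤ ‖G v‖ ^ 2) {u₁ u₂ : K}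
    {y₁ y₂ : H} (h₁ : SolvesVI E G j u₁ y₁) (h₂ : SolvesVI E G j u₂ y₂) :
    ‖y₁ - y₂‖ ≤ α⁻¹ * ‖E.adjoint (u₁ - u₂)‖ := by
  have h := (hG _).trans (h₁.norm_sub_sq_le h₂)
  rw [← ContinuousLinearMap.adjoint_inner_left] at h
  have h' := h.trans (real_inner_le_norm _ _)
  rcases (norm_nonneg (y₁ - y₂)).eq_or_lt with h0 | h0
  · rw [← h0]; positivity
  · rw [inv_mul_eq_div, le_div_iff₀ hα]
    refine le_of_mul_le_mul_right ?_ h0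
    linarith

/-- A vector whose pairings are controlled by the adjoint of `E` lies in the range of `E`. -/
theorem mem_range_of_abs_inner_le_norm_adjoint [CompleteSpace H] [CompleteSpace K]
    (E : H →L[ℝ] K) {w : K} {C : ℝ}
    (h : ∀ k, |inner ℝ w k| ≤ C * ‖E.adjoint k‖) : ∃ g, E g = w := by
  -- This makes `E.adjoint k ↦ inner w k` well defined on the range of the adjoint, whatever
  -- preimage `σ` picks. It is bounded by `h`, and the Riesz representative of a Hahn-Banach
  -- extension is the preimage of `w`.
  have hzero : ∀ k, E.adjoint k = 0 → inner ℝ w k = 0 := by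
    intro k hk
    have := h k
    rw [hk, norm_zero, mul_zero] at this
    exact abs_nonpos_iff.1 this
  let R : Submodule ℝ H := LinearMap.range (E.adjoint : K →ₗ[ℝ] H)
  have hR : ∀ r : R, ∃ k, E.adjoint k = r := fun r => r.2
  choose σ hσ using hR
  let f : R →ₗ[ℝ] ℝ :=
    { toFun := fun r => inner ℝ w (σ r)
      map_add' := fun r s => by
        have := hzero (σ (r + s) - (σ r + σ s)) (by simp [hσ])
        rwa [inner_sub_right, inner_add_right, sub_eq_zero] at this
      map_smul' := fun c r => by
        have := hzero (σ (c • r) - c • σ r) (by simp [hσ])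
        rwa [inner_sub_right, inner_smul_right, sub_eq_zero] at this }
  let fc : StrongDual ℝ R := f.mkContinuous C fun r => by
    have := h (σ r)
    rw [hσ] at this
    exact this
  obtain ⟨g, hg, -⟩ := exists_extension_norm_eq R fc
  refine ⟨(InnerProductSpace.toDual ℝ H).symm g, ext_inner_right ℝ fun k => ?_⟩
  rw [← ContinuousLinearMap.adjoint_inner_right, InnerProductSpace.toDual_symm_apply]
  have hgk : g (E.adjoint k) = inner ℝ w (σ ⟨E.adjoint k, k, rfl⟩) := hg ⟨E.adjoint k, k, rfl⟩
  rw [hgk]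
  have := hzero (σ ⟨E.adjoint k, k, rfl⟩ - k) (by simp [hσ])
  rwa [inner_sub_right, sub_eq_zero] at this

/-- A locally optimal control differs from the desired control by an element of the range of the
embedding `E` of the state space. -/
theorem exists_eq_sub_of_locallyOptimal [CompleteSpace H] [CompleteSpace K]
    (E : H →L[ℝ] K) (G : H →L[ℝ] M) {j : K → ℝ}
    (hj : Continuous j) (hj0 : ∀ x, 0 ≤ j x) (hconv : ConvexOn ℝ Set.univ j) {α : ℝ} (hα : 0 < α)
    (hG : ∀ v, α * ‖v‖ ^ 2 ≤ ‖G v‖ ^ 2) {ν : ℝ} (hν : 0 < ν) (yd ud ubar : K) (ybar : H)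
    (hy : SolvesVI E G j ubar ybar) {ε : ℝ} (hε : 0 < ε)
    (hopt : ∀ u y, ‖u - ubar‖ ≤ ε → SolvesVI E G j u y →
      1 / 2 * ‖E ybar - yd‖ ^ 2 + ν / 2 * ‖ubar - ud‖ ^ 2 ≤
        1 / 2 * ‖E y - yd‖ ^ 2 + ν / 2 * ‖u - ud‖ ^ 2) :
    ∃ p, E p = ubar - ud := by
  set C := ‖E ybar - yd‖ * ‖E‖ * α⁻¹ with hC
  have hlow : ∀ k, 0 ≤ ν * inner ℝ (ubar - ud) k + C * ‖E.adjoint k‖ := by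
    intro k
    -- With this scale the control `ubar + (t * s) • k` stays in the `ε`-ball for every `t ≤ 1`; the
    -- `+ 1` covers `k = 0`.
    set s := ε / (‖k‖ + 1) with hs
    have hs0 : 0 < s := by positivity
    have hsk : s * ‖k‖ ≤ ε := by
      rw [hs, div_mul_eq_mul_div, div_le_iff₀ (by positivity)]
      nlinarith [norm_nonneg k]
    refine nonneg_of_forall_add_mul_nonneg
      (B := s * (1 / 2 * (‖E‖ * (α⁻¹ * ‖E.adjoint k‖)) ^ 2 + ν / 2 * ‖k‖ ^ 2)) fun t ht ht1 => ?_
    set r := t * s with hr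
    have hr0 : 0 < r := by positivity
    obtain ⟨y, hyk⟩ := exists_solvesVI E G hj hj0 hconv hα hG (ubar + r • k)
    have hlip := hyk.norm_sub_le hα hG hy
    rw [add_sub_cancel_left, map_smul, norm_smul, Real.norm_of_nonneg hr0.le] at hlip
    have hE : ‖E y - E ybar‖ ≤ r * (‖E‖ * (α⁻¹ * ‖E.adjoint k‖)) := by
      rw [← map_sub]
      calc ‖E (y - ybar)‖ ≤ ‖E‖ * ‖y - ybar‖ := E.le_opNorm _
        _ ≤ ‖E‖ * (α⁻¹ * (r * ‖E.adjoint k‖)) := by gcongr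
        _ = _ := by ring
    have ho := hopt (ubar + r • k) y (by
      rw [add_sub_cancel_left, norm_smul, Real.norm_of_nonneg hr0.le, hr, mul_assoc]
      nlinarith [norm_nonneg k]) hyk
    have e1 : E y - yd = (E ybar - yd) + (E y - E ybar) := by abel
    have e2 : ubar + r • k - ud = (ubar - ud) + r • k := by abel
    rw [e1, e2, norm_add_sq_real, norm_add_sq_real (ubar - ud), inner_smul_right, norm_smul,
      Real.norm_of_nonneg hr0.le] at ho
    have h1 : inner ℝ (E ybar - yd) (E y - E ybar) ≤ r * (C * ‖E.adjoint k‖) := by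
      refine (real_inner_le_norm _ _).trans ?_
      calc ‖E ybar - yd‖ * ‖E y - E ybar‖
          ≤ ‖E ybar - yd‖ * (r * (‖E‖ * (α⁻¹ * ‖E.adjoint k‖))) := by gcongr
        _ = _ := by rw [hC]; ring
    have h2 : ‖E y - E ybar‖ ^ 2 ≤ (r * (‖E‖ * (α⁻¹ * ‖E.adjoint k‖))) ^ 2 := by gcongr
    refine le_of_mul_le_mul_left ?_ hr0
    rw [mul_zero]
    rw [mul_pow] at h2 ho
    have e3 : t * (s * (1 / 2 * (‖E‖ * (α⁻¹ * ‖E.adjoint k‖)) ^ 2 + ν / 2 * ‖k‖ ^ 2))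
      = r * (1 / 2 * (‖E‖ * (α⁻¹ * ‖E.adjoint k‖)) ^ 2 + ν / 2 * ‖k‖ ^ 2) := by rw [hr]; ring
    rw [e3]
    linarith
  refine mem_range_of_abs_inner_le_norm_adjoint E (C := C / ν) fun k => ?_
  have h1 := hlow k
  have h2 := hlow (-k)
  rw [map_neg, norm_neg, inner_neg_right] at h2
  rw [div_mul_eq_mul_div, abs_le, ← neg_div, div_le_iff₀ hν, le_div_iff₀ hν]
  constructor <;> linarith

end Abstract

/-! ### Sobolev inequalities for test functions in dimensions one, two and three -/

section Sobolev

open scoped ContDiff Gradient NNReal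

variable {d : ℕ} {Ω : Set (EuclideanSpace ℝ (Fin d))}

/-- The Sobolev inequality `‖φ‖_{L^q(Ω)} ≤ C ‖∇φ‖_{L²(Ω)}` for test functions on `Ω`. -/
def SobolevInequality (Ω : Set (EuclideanSpace ℝ (Fin d))) (q : ℝ≥0∞) (C : ℝ≥0) : Prop :=
  ∀ φ : EuclideanSpace ℝ (Fin d) → ℝ, ContDiff ℝ ∞ φ → HasCompactSupport φ → tsupport φ ⊆ Ω →
    eLpNorm φ q (volume.restrict Ω) ≤ C * eLpNorm (∇ φ) 2 (volume.restrict Ω)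

theorem enorm_gradient_eq (φ : EuclideanSpace ℝ (Fin d) → ℝ) (x : EuclideanSpace ℝ (Fin d)) :
    ‖∇ φ x‖ₑ = ‖fderiv ℝ φ x‖ₑ := by
  simp [gradient, enorm_eq_nnnorm]

/-- Hölder's inequality on `Ω`, since the gradient vanishes outside it. -/
theorem eLpNorm_fderiv_le_eLpNorm_gradient {φ : EuclideanSpace ℝ (Fin d) → ℝ}
    (hφ : ContDiff ℝ ∞ φ) (hsupp : tsupport φ ⊆ Ω) {p : ℝ≥0∞} (hp : p ≤ 2) :
    eLpNorm (fderiv ℝ φ) p volume ≤ eLpNorm (∇ φ) 2 (volume.restrict Ω) *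
      volume Ω ^ (1 / p.toReal - 1 / 2) := by
  have hs : Function.support (∇ φ) ⊆ Ω := fun x hx => by
    refine hsupp (support_fderiv_subset ℝ (f := φ) fun h => hx ?_)
    rw [gradient, h, map_zero]
  have heq : eLpNorm (fderiv ℝ φ) p volume = eLpNorm (∇ φ) p volume :=
    eLpNorm_congr_enorm_ae (.of_forall fun x => (enorm_gradient_eq φ x).symm)
  rw [heq, ← eLpNorm_restrict_eq_of_support_subset hs]
  have hcont : Continuous (∇ φ) :=
    (InnerProductSpace.toDual ℝ _).symm.continuous.comp (hφ.continuous_fderiv (by simp))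
  simpa using eLpNorm_le_eLpNorm_mul_rpow_measure_univ (μ := volume.restrict Ω) hp
    hcont.aestronglyMeasurable

/-- Gagliardo-Nirenberg-Sobolev at a subcritical gradient exponent `p < d`, raised to exponent `2`
by boundedness of `Ω`. -/
theorem exists_sobolevInequality_of_lt (hb : Bornology.IsBounded Ω) {p q : ℝ≥0} (hp : 1 ≤ p)
    (hp2 : p ≤ 2) (hpd : p < d) (hpq : (p : ℝ)⁻¹ - (d : ℝ)⁻¹ ≤ (q : ℝ)⁻¹) :
    ∃ C, SobolevInequality Ω q C := by
  have hfin : volume Ω ^ (1 / (p : ℝ) - 1 / 2) ≠ ⊤ := by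
    refine ENNReal.rpow_ne_top_of_nonneg ?_ hb.measure_lt_top.ne
    rw [sub_nonneg]
    exact one_div_le_one_div_of_le (by positivity) (by exact_mod_cast hp2)
  refine ⟨eLpNormLESNormFDerivOfLeConst ℝ volume Ω p q *
    (volume Ω ^ (1 / (p : ℝ) - 1 / 2)).toNNReal, fun φ h1 h2 h3 => ?_⟩
  refine (eLpNorm_restrict_le φ q volume Ω).trans ?_
  refine (eLpNorm_le_eLpNorm_fderiv_of_le volume (h1.of_le (by simp))
    ((subset_tsupport φ).trans h3) hp (by simpa using hpd) (by simpa using hpq) hb).trans ?_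
  rw [ENNReal.coe_mul, ENNReal.coe_toNNReal hfin, mul_assoc]
  gcongr
  rw [mul_comm]
  simpa using eLpNorm_fderiv_le_eLpNorm_gradient h1 h3 (p := p) (by exact_mod_cast hp2)

theorem exists_sobolevInequality_three {Ω : Set (EuclideanSpace ℝ (Fin 3))}
    (hb : Bornology.IsBounded Ω) : ∃ C, SobolevInequality Ω 6 C := by
  have := exists_sobolevInequality_of_lt hb (p := 2) (q := 6) (by norm_num) le_rfl
    (by norm_num) (by norm_num)
  simpa using this

theorem exists_sobolevInequality_two {Ω : Set (EuclideanSpace ℝ (Fin 2))}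
    (hb : Bornology.IsBounded Ω) {q : ℝ≥0} (hq : 2 ≤ q) : ∃ C, SobolevInequality Ω q C := by
  have hq0 : 0 < q := lt_of_lt_of_le (by norm_num) hq
  have hinv : q⁻¹ ≤ 2⁻¹ := inv_anti₀ (by norm_num) hq
  have hsum : q⁻¹ + 2⁻¹ ≤ 1 := by
    calc q⁻¹ + 2⁻¹ ≤ 2⁻¹ + (2 : ℝ≥0)⁻¹ := by gcongr
      _ = 1 := by rw [← NNReal.coe_inj]; norm_num
  have hlt : (q⁻¹ + 2⁻¹)⁻¹ < 2 := by
    rw [inv_lt_comm₀ (by positivity) (by norm_num)]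
    exact lt_add_of_pos_left _ (by positivity)
  -- In the plane `p = 2` is critical, so `p` is chosen with `1/p - 1/2 = 1/q`; then `p < 2`, and `q
  -- ≥ 2` gives `p ≥ 1`.
  refine exists_sobolevInequality_of_lt hb (p := (q⁻¹ + 2⁻¹)⁻¹) ?_ hlt.le hlt ?_
  · rwa [one_le_inv₀ (by positivity)]
  · push_cast
    rw [inv_inv, add_sub_cancel_right]

theorem exists_sobolevInequality_one {Ω : Set (EuclideanSpace ℝ (Fin 1))}
    (hb : Bornology.IsBounded Ω) : ∃ C, SobolevInequality Ω ⊤ C := by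
  have hfin : volume Ω ^ (1 / (1 : ℝ) - 1 / 2) ≠ ⊤ :=
    ENNReal.rpow_ne_top_of_nonneg (by norm_num) hb.measure_lt_top.ne
  refine ⟨(volume Ω ^ (1 / (1 : ℝ) - 1 / 2)).toNNReal, fun φ h1 h2 h3 => ?_⟩
  rw [ENNReal.coe_toNNReal hfin, mul_comm, eLpNorm_exponent_top]
  refine eLpNormEssSup_le_of_ae_enorm_bound (.of_forall fun x => ?_)
  -- Fundamental theorem of calculus for a compactly supported function, transported along the
  -- isometry `e` with the real line.
  have key : ‖φ x‖ₑ ≤ eLpNorm (fderiv ℝ φ) 1 volume := by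
    let e : ℝ ≃ₗᵢ[ℝ] EuclideanSpace ℝ (Fin 1) := (OrthonormalBasis.singleton (Fin 1) ℝ).repr
    have hcd : ContDiff ℝ 1 (φ ∘ e) := (h1.of_le (by simp)).comp e.contDiff
    have hcs : HasCompactSupport (φ ∘ e) := h2.comp_homeomorph e.toHomeomorph
    have hle := HasCompactSupport.enorm_le_lintegral_Ici_deriv hcd hcs (e.symm x)
    rw [Function.comp_apply, e.apply_symm_apply] at hle
    refine hle.trans (setLIntegral_le_lintegral _ _) |>.trans ?_
    rw [eLpNorm_one_eq_lintegral_enorm,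
      ← e.measurePreserving.lintegral_comp_emb e.toHomeomorph.measurableEmbedding]
    refine lintegral_mono fun t => ?_
    have hder : deriv (φ ∘ e) t = fderiv ℝ φ (e t) (e 1) := by
      have ha : HasFDerivAt φ (fderiv ℝ φ (e t)) (e t) :=
        (h1.differentiable (by simp) _).hasFDerivAt
      have hb : HasDerivAt (e : ℝ → EuclideanSpace ℝ (Fin 1)) (e 1) t := by
        simpa using (e.toContinuousLinearEquiv.hasFDerivAt (x := t)).hasDerivAt
      exact (ha.comp_hasDerivAt t hb).deriv
    rw [hder]
    refine (ContinuousLinearMap.le_opENorm _ _).trans ?_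
    rw [show ‖e 1‖ₑ = 1 by simp [e.enorm_map], mul_one]
  refine key.trans ?_
  simpa using eLpNorm_fderiv_le_eLpNorm_gradient h1 h3 (p := 1) (by norm_num)

end Sobolev

/-! ### Passage to `H¹₀(Ω)` and regularity of the control -/

namespace VIControl

open scoped ContDiff Gradient NNReal
open Filter Topology

variable {d : ℕ} {Ω : Set (EuclideanSpace ℝ (Fin d))}

theorem exists_sobolevInequality_of_exponent_le (hb : Bornology.IsBounded Ω) {p q : ℝ≥0∞}
    (hpq : p ≤ q) (hp : p ≠ 0) {C : ℝ≥0} (h : SobolevInequality Ω q C) :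
    ∃ C', SobolevInequality Ω p C' := by
  rcases eq_or_ne p ⊤ with rfl | hp'
  · obtain rfl : q = ⊤ := top_le_iff.1 hpq
    exact ⟨C, h⟩
  have hfin : volume Ω ^ (1 / p.toReal - 1 / q.toReal) ≠ ⊤ := by
    refine ENNReal.rpow_ne_top_of_nonneg ?_ hb.measure_lt_top.ne
    rw [sub_nonneg]
    rcases eq_or_ne q ⊤ with rfl | hq'
    · simp
    · exact one_div_le_one_div_of_le (ENNReal.toReal_pos hp hp') (ENNReal.toReal_mono hq' hpq)
  refine ⟨(volume Ω ^ (1 / p.toReal - 1 / q.toReal)).toNNReal * C, fun φ h1 h2 h3 => ?_⟩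
  refine (eLpNorm_le_eLpNorm_mul_rpow_measure_univ hpq
    h1.continuous.aestronglyMeasurable).trans ?_
  rw [ENNReal.coe_mul, ENNReal.coe_toNNReal hfin, Measure.restrict_apply_univ, mul_comm, mul_assoc]
  gcongr
  exact h φ h1 h2 h3

/-- The Sobolev inequality extends from test functions to `H¹₀(Ω)`. -/
theorem eLpNorm_fst_le_of_mem_H10 {q : ℝ≥0∞} {C : ℝ≥0} (h : SobolevInequality Ω q C)
    {w : GraphSpace Ω} (hw : w ∈ H10 Ω) :
    eLpNorm w.fst q (volume.restrict Ω) ≤ C * ‖w.snd‖ₑ := by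
  obtain ⟨s, hs, hlim⟩ := mem_closure_iff_seq_limit.1
    (show w ∈ closure (testFunctions Ω : Set (GraphSpace Ω)) from hw)
  have hfst : Tendsto (fun n => (s n).fst) atTop (𝓝 w.fst) :=
    ((WithLp.prod_continuous_ofLp 2 _ _).fst.tendsto w).comp hlim
  have hsnd : Tendsto (fun n => (s n).snd) atTop (𝓝 w.snd) :=
    ((WithLp.prod_continuous_ofLp 2 _ _).snd.tendsto w).comp hlim
  obtain ⟨ns, hns, hae⟩ := (tendstoInMeasure_of_tendsto_Lp hfst).exists_seq_tendsto_ae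
  -- Fatou's lemma along an almost everywhere convergent subsequence, so no convergence in `L^q` has
  -- to be known.
  refine (Lp.eLpNorm_lim_le_liminf_eLpNorm (fun n => Lp.aestronglyMeasurable _) _ hae).trans ?_
  have hR : Tendsto (fun n => (C : ℝ≥0∞) * ‖(s (ns n)).snd‖ₑ) atTop (𝓝 (C * ‖w.snd‖ₑ)) :=
    ENNReal.Tendsto.const_mul ((continuous_enorm.tendsto _).comp (hsnd.comp hns.tendsto_atTop))
      (.inr ENNReal.coe_ne_top)
  rw [← hR.liminf_eq]
  refine liminf_le_liminf (.of_forall fun n => ?_)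
  obtain ⟨φ, h1, h2, h3, h4, h5⟩ := hs (ns n)
  rw [eLpNorm_congr_ae h4, Lp.enorm_def, eLpNorm_congr_ae h5]
  exact h φ h1 h2 h3

theorem memLp_fst_of_mem_H10 {q : ℝ≥0∞} {C : ℝ≥0} (h : SobolevInequality Ω q C)
    {w : GraphSpace Ω} (hw : w ∈ H10 Ω) : MemLp w.fst q (volume.restrict Ω) :=
  ⟨Lp.aestronglyMeasurable _, (eLpNorm_fst_le_of_mem_H10 h hw).trans_lt
    (ENNReal.mul_lt_top ENNReal.coe_lt_top enorm_lt_top)⟩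

theorem norm_fst_le_of_mem_H10 {C : ℝ≥0} (h : SobolevInequality Ω 2 C)
    {w : GraphSpace Ω} (hw : w ∈ H10 Ω) : ‖w.fst‖ ≤ C * ‖w.snd‖ := by
  have := eLpNorm_fst_le_of_mem_H10 h hw
  rw [← Lp.enorm_def] at this
  have h2 := ENNReal.toReal_mono (by finiteness) this
  simpa using h2

instance completeSpace_H10 : CompleteSpace (H10 Ω) :=
  (testFunctions Ω).isClosed_topologicalClosure.completeSpace_coe

/-- The embedding of `H¹₀(Ω)` into `L²(Ω)`. -/
noncomputable def embedding (Ω : Set (EuclideanSpace ℝ (Fin d))) : H10 Ω →L[ℝ] L2 Ω :=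
  (WithLp.fstL 2 ℝ (L2 Ω) (L2Vec Ω)).comp (H10 Ω).subtypeL

/-- The weak gradient on `H¹₀(Ω)`. -/
noncomputable def weakGradient (Ω : Set (EuclideanSpace ℝ (Fin d))) : H10 Ω →L[ℝ] L2Vec Ω :=
  (WithLp.sndL 2 ℝ (L2 Ω) (L2Vec Ω)).comp (H10 Ω).subtypeL

theorem embedding_apply (v : H10 Ω) : embedding Ω v = (v : GraphSpace Ω).fst := rfl

theorem weakGradient_apply (v : H10 Ω) : weakGradient Ω v = (v : GraphSpace Ω).snd := rfl

/-- Coercivity of the Dirichlet form on `H¹₀(Ω)`. -/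
theorem norm_sq_le_norm_weakGradient_sq {C : ℝ≥0} (h : SobolevInequality Ω 2 C) (v : H10 Ω) :
    ((C : ℝ) ^ 2 + 1)⁻¹ * ‖v‖ ^ 2 ≤ ‖weakGradient Ω v‖ ^ 2 := by
  have h1 := norm_fst_le_of_mem_H10 h v.2
  rw [inv_mul_le_iff₀ (by positivity), weakGradient_apply, Submodule.coe_norm,
    WithLp.prod_norm_sq_eq_of_L2]
  have h2 : ‖(v : GraphSpace Ω).fst‖ ^ 2 ≤ (C * ‖(v : GraphSpace Ω).snd‖) ^ 2 := by gcongr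
  linarith

/-- The `L¹(Ω)` norm on `L²(Ω)`. -/
noncomputable def normL1 (w : L2 Ω) : ℝ := ∫ x in Ω, |w x|

theorem normL1_nonneg (w : L2 Ω) : 0 ≤ normL1 w := integral_nonneg fun _ => abs_nonneg _

theorem integrable_of_isBounded (hb : Bornology.IsBounded Ω) (w : L2 Ω) :
    Integrable w (volume.restrict Ω) :=
  have : IsFiniteMeasure (volume.restrict Ω) := ⟨by simpa using hb.measure_lt_top⟩
  (Lp.memLp w).integrable (by norm_num)

theorem convexOn_normL1 (hb : Bornology.IsBounded Ω) :
    ConvexOn ℝ Set.univ (normL1 (Ω := Ω)) := by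
  refine ⟨convex_univ, fun v _ w _ a b ha hb' _ => ?_⟩
  have hv := (integrable_of_isBounded hb v).abs
  have hw := (integrable_of_isBounded hb w).abs
  simp only [normL1, smul_eq_mul]
  rw [← integral_const_mul, ← integral_const_mul,
    ← integral_add (hv.const_mul a) (hw.const_mul b)]
  refine integral_mono_ae (integrable_of_isBounded hb _).abs
    ((hv.const_mul a).add (hw.const_mul b)) ?_
  filter_upwards [Lp.coeFn_add (a • v) (b • w), Lp.coeFn_smul a v, Lp.coeFn_smul b w]
    with x h1 h2 h3
  rw [h1, Pi.add_apply, h2, h3]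
  simp only [Pi.smul_apply, smul_eq_mul]
  refine (abs_add_le _ _).trans ?_
  rw [abs_mul, abs_mul, abs_of_nonneg ha, abs_of_nonneg hb']

theorem continuous_normL1 (hb : Bornology.IsBounded Ω) : Continuous (normL1 (Ω := Ω)) := by
  have hμ : volume.restrict Ω Set.univ ≠ ⊤ := by simpa using hb.measure_lt_top.ne
  -- Pairing `|w|` with the constant `1`, which is in `L²` as `Ω` has finite measure, reduces the
  -- claim to continuity of the lattice operations.
  have heq : (normL1 (Ω := Ω)) =
      fun w => inner ℝ (indicatorConstLp 2 MeasurableSet.univ hμ (1 : ℝ)) |w| := by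
    funext w
    rw [L2.inner_indicatorConstLp_one, Measure.restrict_univ]
    refine integral_congr_ae ?_
    filter_upwards [Lp.coeFn_abs w] with x hx using hx.symm
  rw [heq]
  exact continuous_const.inner (continuous_id.sup continuous_neg)

theorem inner_eq_setIntegral_mul_sub (u v w : L2 Ω) :
    inner ℝ u (v - w) = ∫ x in Ω, u x * (v x - w x) := by
  rw [L2.inner_def]
  refine integral_congr_ae ?_
  filter_upwards [Lp.coeFn_sub v w] with x hx
  rw [hx, Pi.sub_apply]
  simp [mul_comm]

theorem inner_eq_setIntegral_inner_sub (u v w : L2Vec Ω) :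
    inner ℝ u (v - w) = ∫ x in Ω, inner ℝ (u x) (v x - w x) := by
  rw [L2.inner_def]
  refine integral_congr_ae ?_
  filter_upwards [Lp.coeFn_sub v w] with x hx
  rw [hx, Pi.sub_apply]

theorem isState_iff_solvesVI (u : L2 Ω) (y : H10 Ω) :
    IsState Ω u y ↔ SolvesVI (embedding Ω) (weakGradient Ω) normL1 u y := by
  simp only [IsState, SolvesVI, y.2, true_and, Subtype.forall, inner_eq_setIntegral_mul_sub,
    inner_eq_setIntegral_inner_sub, embedding_apply, weakGradient_apply, normL1]

/-- A locally optimal control differs from the desired control by an element of `H¹₀(Ω)`. -/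
theorem IsLocallyOptimal.exists_mem_H10 (hb : Bornology.IsBounded Ω) {C : ℝ≥0}
    (hP : SobolevInequality Ω 2 C) {ν : ℝ} (hν : 0 < ν) {yd ud ubar : L2 Ω}
    (h : IsLocallyOptimal Ω ν yd ud ubar) : ∃ p ∈ H10 Ω, p.fst = ubar - ud := by
  obtain ⟨ybar, hy, ε, hε, hopt⟩ := h
  obtain ⟨p, hp⟩ := exists_eq_sub_of_locallyOptimal (embedding Ω) (weakGradient Ω)
    (continuous_normL1 hb) normL1_nonneg (convexOn_normL1 hb) (by positivity)
    (norm_sq_le_norm_weakGradient_sq hP) hν yd ud ubar ⟨ybar, hy.1⟩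
    ((isState_iff_solvesVI ubar ⟨ybar, hy.1⟩).1 hy) hε
    fun u y hu hs => hopt u y hu ((isState_iff_solvesVI u y).2 hs)
  exact ⟨p, p.2, hp⟩

theorem IsLocallyOptimal.memLp (hb : Bornology.IsBounded Ω) {q : ℝ≥0∞} (hq : 2 ≤ q) {C : ℝ≥0}
    (hS : SobolevInequality Ω q C) {ν : ℝ} (hν : 0 < ν) {yd ud ubar : L2 Ω}
    (hud : MemLp ud ⊤ (volume.restrict Ω)) (h : IsLocallyOptimal Ω ν yd ud ubar) :
    MemLp ubar q (volume.restrict Ω) := by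
  have : IsFiniteMeasure (volume.restrict Ω) := ⟨by simpa using hb.measure_lt_top⟩
  obtain ⟨C', hP⟩ := exists_sobolevInequality_of_exponent_le hb hq (by norm_num) hS
  obtain ⟨p, hp, hpu⟩ := h.exists_mem_H10 hb hP hν
  have h1 := (memLp_fst_of_mem_H10 hS hp).add (hud.mono_exponent (p := q) le_top)
  refine (memLp_congr_ae ?_).1 h1
  rw [hpu]
  filter_upwards [Lp.coeFn_sub ubar ud] with x hx
  rw [Pi.add_apply, hx, Pi.sub_apply, sub_add_cancel]

end VIControl

theorem proposition2p5 {d : ℕ} (Ω : Set (EuclideanSpace ℝ (Fin d)))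
    (hΩ_open : IsOpen Ω) (hΩ_bdd : Bornology.IsBounded Ω)
    (ν : ℝ) (hν : 0 < ν)
    (yd ud : VIControl.L2 Ω) (hud : MemLp ud ∞ (volume.restrict Ω))
    (ubar : VIControl.L2 Ω) (hubar : VIControl.IsLocallyOptimal Ω ν yd ud ubar) :
    (d = 1 → MemLp ubar ∞ (volume.restrict Ω)) ∧
    (d = 2 → ∀ κ : ℝ≥0∞, 1 ≤ κ → κ < ∞ → MemLp ubar κ (volume.restrict Ω)) ∧
    (d = 3 → MemLp ubar 6 (volume.restrict Ω)) := by
  refine ⟨?_, ?_, ?_⟩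
  · rintro rfl
    obtain ⟨C, hC⟩ := exists_sobolevInequality_one hΩ_bdd
    exact hubar.memLp hΩ_bdd le_top hC hν hud
  · rintro rfl κ - hκ
    have : IsFiniteMeasure (volume.restrict Ω) := ⟨by simpa using hΩ_bdd.measure_lt_top⟩
    lift κ to NNReal using hκ.ne
    -- The Sobolev argument needs exponent at least `2`; smaller `κ` follow from finite measure.
    obtain ⟨C, hC⟩ := exists_sobolevInequality_two hΩ_bdd (le_max_right κ 2)
    exact (hubar.memLp hΩ_bdd (by exact_mod_cast le_max_right κ 2) hC hν hud).mono_exponent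
      (by exact_mod_cast le_max_left κ 2)
  · rintro rfl
    obtain ⟨C, hC⟩ := exists_sobolevInequality_three hΩ_bdd
    exact hubar.memLp hΩ_bdd (by norm_num) hC hν hud
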